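/- Let $(\Omega,\mathcal F)$ be a measurable space and let $\mathcal X$ be the set of bounded measurable functions $X:\Omega\to\mathbb R$. A \emph{capacity} is a function $w:\mathcal F\to\mathbb R$ with $w(\varnothing)=0$, $w(\Omega)=1$ and $w(A)\le w(B)$ whenever $A\subseteq B$; it is \emph{submodular} if $w(A\cup B)+w(A\cap B)\le w(A)+w(B)$ for all $A,B\in\mathcal F$. Let $\mathcal S$ be the set of submodular capacities. For a capacity $w$ and $X\in\mathcal X$, the Choquet integral is $$I_w(X)=\int_{-\infty}^0\bigl(w(X\ge x)-1\bigr)\,dx+\int_0^\infty w(X\ge x)\,dx .$$ For $t\in[0,1)$ put $\mathrm{VaR}^w_t(X)=\inf\{x\in\mathbb R: w(X\ge x)\le t\}$, and for $\alpha\in(0,1]$ define the Choquet Expected Shortfall $$\mathrm{ES}^w_\alpha(X)=\frac1\alpha\int_0^\alpha \mathrm{VaR}^w_t(X)\,dt .$$ The inf-convolution of $\rho_1,\dots,\rho_n:\mathcal X\to\mathbb R$ is $$\mathop{\square}_{i=1}^n\rho_i(X)=\inf\Bigl\{\sum_{i=1}^n\rho_i(X_i): X_1,\dots,X_n\in\mathcal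 X,\ \sum_{i=1}^nX_i=X\Bigr\}\in[-\infty,\infty),\qquad X\in\mathcal X .$$ Let $n\ge1$ and $\alpha_1,\dots,\alpha_n\in(0,1]$. Then for all submodular capacities $w_1,\dots,w_n\in\mathcal S$ and all $X\in\mathcal X$, $$\mathop{\square}_{i=1}^n\mathrm{ES}^{w_i}_{\alpha_i}(X)=\sup\Bigl\{I_w(X): w\in\mathcal S,\ w(A)\le\min_{1\le i\le n}\frac{w_i(A)}{\alpha_i}\text{ for all }A\in\mathcal F\Bigr\},$$ where $\sup\varnothing=-\infty$. In particular, for every submodular capacity $w$ and all $X\in\mathcal X$, $$\mathop{\square}_{i=1}^n\mathrm{ES}^{w}_{\alpha_i}(X)=\mathrm{ES}^{w}_{\max\{\alpha_1,\dots,\alpha_n\}}(X).$$ -/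

import Mathlib

namespace ChoquetES

/-- The measurable sets of `Ω`, that is, the σ-algebra as a type. Mathlib equips it with its
Boolean algebra structure (`⊔` is union, `⊓` is intersection, `≤` is inclusion). -/
abbrev MSet (Ω : Type*) [MeasurableSpace Ω] : Type _ := {A : Set Ω // MeasurableSet A}

/-- A capacity: an increasing real-valued function on the σ-algebra with value `0` at the empty
set and value `1` at the whole space. -/
structure Capacity (Ω : Type*) [MeasurableSpace Ω] where
  toFun : MSet Ω → ℝ
  increasing : ∀ A B : MSet Ω, (A : Set Ω) ⊆ (B : Set Ω) → toFun A ≤ toFun B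
  empty : toFun ⟨∅, MeasurableSet.empty⟩ = 0
  whole : toFun ⟨Set.univ, MeasurableSet.univ⟩ = 1

instance (Ω : Type*) [MeasurableSpace Ω] : CoeFun (Capacity Ω) (fun _ => MSet Ω → ℝ) :=
  ⟨Capacity.toFun⟩

/-- Submodularity of a capacity. -/
def Capacity.IsSubmodular {Ω : Type*} [MeasurableSpace Ω] (w : Capacity Ω) : Prop :=
  ∀ A B : MSet Ω, w (A ⊔ B) + w (A ⊓ B) ≤ w A + w B

/-- The space of bounded random variables: bounded measurable real functions on `Ω`. -/
def BddRV (Ω : Type*) [MeasurableSpace Ω] : Submodule ℝ (Ω → ℝ) where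
  carrier := {X | Measurable X ∧ ∃ C : ℝ, ∀ ω, |X ω| ≤ C}
  zero_mem' := ⟨measurable_const, 0, fun ω => by simp⟩
  add_mem' := by
    rintro X Y ⟨hX, C, hC⟩ ⟨hY, D, hD⟩
    exact ⟨hX.add hY, C + D, fun ω => (abs_add_le _ _).trans (add_le_add (hC ω) (hD ω))⟩
  smul_mem' := by
    rintro c X ⟨hX, C, hC⟩
    refine ⟨hX.const_smul c, |c| * C, fun ω => ?_⟩
    rw [Pi.smul_apply, smul_eq_mul, abs_mul]
    exact mul_le_mul_of_nonneg_left (hC ω) (abs_nonneg c)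

/-- The event `{X ≥ x}`. -/
def eventGE {Ω : Type*} [MeasurableSpace Ω] (X : BddRV Ω) (x : ℝ) : MSet Ω :=
  ⟨{ω | x ≤ (X : Ω → ℝ) ω}, measurableSet_le measurable_const X.2.1⟩

/-- The Choquet integral
`I_w(X) = ∫_{-∞}^0 (w(X ≥ x) - 1) dx + ∫_0^∞ w(X ≥ x) dx`. Since `X` is bounded, both integrands
are bounded, monotone and vanish outside a bounded interval. -/
noncomputable def choquet {Ω : Type*} [MeasurableSpace Ω] (w : Capacity Ω) (X : BddRV Ω) : ℝ :=
  (∫ x in Set.Iic (0 : ℝ), (w (eventGE X x) - 1)) + ∫ x in Set.Ioi (0 : ℝ), w (eventGE X x)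

/-- The left Choquet quantile `Q^w_a(X) = inf {x : w(X ≥ x) ≤ 1 - a}`, for `a ∈ (0,1]`. -/
noncomputable def leftQuantile {Ω : Type*} [MeasurableSpace Ω] (w : Capacity Ω) (a : ℝ)
    (X : BddRV Ω) : ℝ :=
  sInf {x : ℝ | w (eventGE X x) ≤ 1 - a}

/-- `VaR^w_t = Q^w_{1-t}`, for `t ∈ [0,1)`. -/
noncomputable def VaR {Ω : Type*} [MeasurableSpace Ω] (w : Capacity Ω) (t : ℝ)
    (X : BddRV Ω) : ℝ :=
  leftQuantile w (1 - t) X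

/-- The Choquet Expected Shortfall `ES^w_α(X) = (1/α) ∫_0^α VaR^w_t(X) dt`, for `α ∈ (0,1]`.
The integrand is bounded and monotone in `t` on `[0,1)`; for `α = 1` the endpoint `t = 1` is a
null set. -/
noncomputable def ES {Ω : Type*} [MeasurableSpace Ω] (w : Capacity Ω) (α : ℝ)
    (X : BddRV Ω) : ℝ :=
  (1 / α) * ∫ t in (0 : ℝ)..α, VaR w t X

/-- The allocations of `X` among `n` agents. -/
def allocations {Ω : Type*} [MeasurableSpace Ω] (n : ℕ) (X : BddRV Ω) :
    Set (Fin n → BddRV Ω) :=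
  {Y | ∑ i, Y i = X}

/-- The inf-convolution of `ρ_1, …, ρ_n`, as an infimum in the extended reals. -/
noncomputable def infConvolution {Ω : Type*} [MeasurableSpace Ω] {n : ℕ}
    (ρ : Fin n → BddRV Ω → ℝ) (X : BddRV Ω) : EReal :=
  ⨅ Y ∈ allocations n X, ((∑ i, ρ i (Y i) : ℝ) : EReal)

end ChoquetES

/-! By Fubini, applied to the indicator of `t < w (X ≥ x)`, `ES w α` is the Choquet integral of the
capacity `min (w / α) 1` (`ES_eq_choquet_truncate`). Truncation preserves submodularity, so the
question concerns the inf-convolution of Choquet integrals of submodular capacities `v i`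
(`infConvolution_choquet`).

If `u` is submodular and lies below every `v i`, subadditivity of its Choquet integral bounds each
allocation from below by `choquet u X`. Conversely, by Hahn–Banach, a real lower bound `m` of the
inf-convolution at `X` gives a linear functional `l`, dominated by every `choquet (v i)`, with `m ≤
l X`. Its values on indicators form an additive capacity `u` below every `v i`, and `l X ≤ choquet u
X`.

One staircase argument, `add_le_add_choquet`, gives both subadditivity and the bound of `l` by
`choquet u`. For a common `w` the constraint with the largest `α i` implies the others, and its
truncation is the largest competitor. -/

namespace ChoquetES

open MeasureTheory Set

variable {Ω : Type*} [MeasurableSpace Ω]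

/-! ### Bounded random variables -/

/-- The indicator function of a measurable set. -/
noncomputable def indicatorRV (A : MSet Ω) : BddRV Ω :=
  ⟨(A : Set Ω).indicator 1, measurable_one.indicator A.2, 1, fun ω => by
    by_cases h : ω ∈ (A : Set Ω) <;> simp [h]⟩

/-- A constant random variable. -/
def constRV (c : ℝ) : BddRV Ω := ⟨fun _ => c, measurable_const, |c|, fun _ => le_rfl⟩

@[simp] theorem constRV_apply (c : ℝ) (ω : Ω) : (constRV c : BddRV Ω).1 ω = c := rfl

@[simp] theorem add_val_apply (X Y : BddRV Ω) (ω : Ω) : (X + Y).1 ω = X.1 ω + Y.1 ω := rfl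

@[simp] theorem smul_val_apply (c : ℝ) (X : BddRV Ω) (ω : Ω) : (c • X).1 ω = c * X.1 ω := rfl

theorem indicatorRV_of_mem {A : MSet Ω} {ω : Ω} (h : ω ∈ (A : Set Ω)) :
    (indicatorRV A).1 ω = 1 := by simp [indicatorRV, h]

theorem indicatorRV_of_notMem {A : MSet Ω} {ω : Ω} (h : ω ∉ (A : Set Ω)) :
    (indicatorRV A).1 ω = 0 := by simp [indicatorRV, h]

theorem exists_bounds (X : BddRV Ω) : ∃ a b : ℝ, a ≤ b ∧ (∀ ω, a ≤ X.1 ω) ∧ ∀ ω, X.1 ω ≤ b := by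
  obtain ⟨C, hC⟩ := X.2.2
  refine ⟨-|C|, |C|, by linarith [abs_nonneg C], fun ω => ?_, fun ω => ?_⟩
  · linarith [hC ω, neg_abs_le (X.1 ω), le_abs_self C]
  · linarith [hC ω, le_abs_self (X.1 ω), le_abs_self C]

/-! ### Capacities and the Choquet integral -/

namespace Capacity

theorem nonneg (w : Capacity Ω) (A : MSet Ω) : 0 ≤ w A :=
  w.empty ▸ w.increasing ⟨∅, MeasurableSet.empty⟩ A (empty_subset _)

theorem le_one (w : Capacity Ω) (A : MSet Ω) : w A ≤ 1 :=
  w.whole ▸ w.increasing A ⟨univ, MeasurableSet.univ⟩ (subset_univ _)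

theorem eq_one (w : Capacity Ω) {A : MSet Ω} (h : ∀ ω, ω ∈ (A : Set Ω)) : w A = 1 := by
  have : A = ⟨univ, MeasurableSet.univ⟩ := Subtype.ext (eq_univ_of_forall h)
  rw [this, w.whole]

theorem eq_zero (w : Capacity Ω) {A : MSet Ω} (h : ∀ ω, ω ∉ (A : Set Ω)) : w A = 0 := by
  have : A = ⟨∅, MeasurableSet.empty⟩ := Subtype.ext (eq_empty_of_forall_notMem h)
  rw [this, w.empty]

end Capacity

theorem antitone_eventGE (w : Capacity Ω) (X : BddRV Ω) : Antitone fun x => w (eventGE X x) :=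
  fun _ _ hxy => w.increasing _ _ fun _ hω => hxy.trans hω

theorem eventGE_eq_one (w : Capacity Ω) {X : BddRV Ω} {a x : ℝ} (ha : ∀ ω, a ≤ X.1 ω)
    (hx : x ≤ a) : w (eventGE X x) = 1 :=
  w.eq_one fun ω => hx.trans (ha ω)

theorem eventGE_eq_zero (w : Capacity Ω) {X : BddRV Ω} {b x : ℝ} (hb : ∀ ω, X.1 ω ≤ b)
    (hx : b < x) : w (eventGE X x) = 0 :=
  w.eq_zero fun ω hω => absurd (hω.trans (hb ω)) (not_le.2 hx)

theorem intervalIntegrable_eventGE (w : Capacity Ω) (X : BddRV Ω) (a b : ℝ) :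
    IntervalIntegrable (fun x => w (eventGE X x)) volume a b :=
  (antitone_eventGE w X).intervalIntegrable

theorem integral_eventGE_below (w : Capacity Ω) {X : BddRV Ω} {a m : ℝ} (ha : ∀ ω, a ≤ X.1 ω)
    (hm : m ≤ a) : ∫ x in m..a, w (eventGE X x) = a - m := by
  rw [intervalIntegral.integral_congr (g := fun _ => (1 : ℝ))]
  · simp
  · intro x hx
    rw [uIcc_of_le hm] at hx
    exact eventGE_eq_one w ha hx.2

theorem integral_eventGE_above (w : Capacity Ω) {X : BddRV Ω} {b M : ℝ} (hb : ∀ ω, X.1 ω ≤ b)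
    (hM : b ≤ M) : ∫ x in b..M, w (eventGE X x) = 0 := by
  rw [intervalIntegral.integral_of_le hM]
  exact setIntegral_eq_zero_of_forall_eq_zero fun x hx => eventGE_eq_zero w hb hx.1

/-- The Choquet integral as an integral over any interval that contains the range. -/
theorem choquet_eq (w : Capacity Ω) {X : BddRV Ω} {a b : ℝ} (ha : ∀ ω, a ≤ X.1 ω)
    (hb : ∀ ω, X.1 ω ≤ b) : choquet w X = a + ∫ x in a..b, w (eventGE X x) := by
  have h1 : ∫ x in Iic (0 : ℝ), (w (eventGE X x) - 1)
      = ∫ x in (min a 0)..0, (w (eventGE X x) - 1) := by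
    rw [intervalIntegral.integral_of_le (min_le_right _ _)]
    refine setIntegral_eq_of_subset_of_forall_sdiff_eq_zero measurableSet_Iic
      (fun x hx => hx.2) fun x hx => ?_
    have : x ≤ min a 0 := by
      by_contra h
      exact hx.2 ⟨not_le.1 h, hx.1⟩
    rw [eventGE_eq_one w ha (this.trans (min_le_left _ _)), sub_self]
  have h2 : ∫ x in Ioi (0 : ℝ), w (eventGE X x) = ∫ x in 0..(max b 0), w (eventGE X x) := by
    rw [intervalIntegral.integral_of_le (le_max_right _ _)]
    refine setIntegral_eq_of_subset_of_forall_sdiff_eq_zero measurableSet_Ioi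
      (fun x hx => hx.1) fun x hx => ?_
    refine eventGE_eq_zero w hb ((le_max_left b 0).trans_lt ?_)
    by_contra h
    exact hx.2 ⟨hx.1, not_lt.1 h⟩
  have hi := intervalIntegrable_eventGE w X
  rw [choquet, h1, h2, intervalIntegral.integral_sub (hi _ _) (by simp)]
  have e1 := integral_eventGE_below w ha (min_le_left a 0)
  have e2 := integral_eventGE_above w hb (le_max_left b 0)
  have e3 := intervalIntegral.integral_add_adjacent_intervals (hi (min a 0) 0) (hi 0 (max b 0))
  have e4 := intervalIntegral.integral_add_adjacent_intervals (hi (min a 0) a) (hi a b)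
  have e5 := intervalIntegral.integral_add_adjacent_intervals (hi (min a 0) b) (hi b (max b 0))
  simp only [intervalIntegral.integral_const, smul_eq_mul, mul_one]
  linarith

theorem choquet_mono_capacity {u v : Capacity Ω} (h : ∀ A, u A ≤ v A) (X : BddRV Ω) :
    choquet u X ≤ choquet v X := by
  obtain ⟨a, b, hab, ha, hb⟩ := exists_bounds X
  rw [choquet_eq u ha hb, choquet_eq v ha hb]
  gcongr
  exact intervalIntegral.integral_mono_on hab (intervalIntegrable_eventGE _ _ _ _)
    (intervalIntegrable_eventGE _ _ _ _) fun x _ => h _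

theorem choquet_mono (w : Capacity Ω) {X Y : BddRV Ω} (h : ∀ ω, X.1 ω ≤ Y.1 ω) :
    choquet w X ≤ choquet w Y := by
  obtain ⟨a, b, hab, ha, hb⟩ := exists_bounds X
  obtain ⟨c, d, hcd, hc, hd⟩ := exists_bounds Y
  have hle : min a c ≤ max b d := (min_le_left _ _).trans (hab.trans (le_max_left _ _))
  rw [choquet_eq w (X := X) (fun ω => (min_le_left a c).trans (ha ω))
      (fun ω => (hb ω).trans (le_max_left b d)),
    choquet_eq w (X := Y) (fun ω => (min_le_right a c).trans (hc ω))
      (fun ω => (hd ω).trans (le_max_right b d))]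
  gcongr
  exact intervalIntegral.integral_mono_on hle (intervalIntegrable_eventGE _ _ _ _)
    (intervalIntegrable_eventGE _ _ _ _)
    fun x _ => w.increasing _ _ fun ω hω => le_trans hω (h ω)

theorem choquet_add_const (w : Capacity Ω) (X : BddRV Ω) (c : ℝ) :
    choquet w (X + constRV c) = choquet w X + c := by
  obtain ⟨a, b, -, ha, hb⟩ := exists_bounds X
  rw [choquet_eq w ha hb, choquet_eq w (X := X + constRV c) (a := a + c) (b := b + c)
    (fun ω => by simpa using ha ω) (fun ω => by simpa using hb ω)]
  have h : ∀ x, eventGE (X + constRV c) x = eventGE X (x - c) := fun x =>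
    Subtype.ext (by ext ω; simp [eventGE])
  simp only [h]
  rw [intervalIntegral.integral_comp_sub_right (fun x => w (eventGE X x)) c]
  simp only [add_sub_cancel_right]
  ring

theorem choquet_smul (w : Capacity Ω) (X : BddRV Ω) {c : ℝ} (hc : 0 < c) :
    choquet w (c • X) = c * choquet w X := by
  obtain ⟨a, b, -, ha, hb⟩ := exists_bounds X
  rw [choquet_eq w ha hb, choquet_eq w (X := c • X) (a := c * a) (b := c * b)
    (fun ω => mul_le_mul_of_nonneg_left (ha ω) hc.le)
    (fun ω => mul_le_mul_of_nonneg_left (hb ω) hc.le)]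
  have h : ∀ x, eventGE (c • X) x = eventGE X (x / c) := fun x =>
    Subtype.ext (by ext ω; simp [eventGE, div_le_iff₀' hc])
  simp only [h]
  rw [intervalIntegral.integral_comp_div (fun x => w (eventGE X x)) hc.ne',
    mul_div_cancel_left₀ _ hc.ne', mul_div_cancel_left₀ _ hc.ne', smul_eq_mul]
  ring

theorem choquet_const (w : Capacity Ω) (c : ℝ) : choquet w (constRV c) = c := by
  rw [choquet_eq w (a := c) (b := c) (fun _ => le_rfl) (fun _ => le_rfl)]
  simp

theorem choquet_zero (w : Capacity Ω) : choquet w (0 : BddRV Ω) = 0 := choquet_const w 0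

theorem choquet_indicatorRV (w : Capacity Ω) (A : MSet Ω) : choquet w (indicatorRV A) = w A := by
  rw [choquet_eq w (a := 0) (b := 1)]
  · rw [intervalIntegral.integral_of_le zero_le_one,
      setIntegral_congr_fun (g := fun _ => w A) measurableSet_Ioc]
    · simp
    · intro x hx
      have : eventGE (indicatorRV A) x = A := Subtype.ext <| by
        ext ω
        by_cases h : ω ∈ (A : Set Ω)
        · simp [eventGE, indicatorRV_of_mem h, h, hx.2]
        · simp [eventGE, indicatorRV_of_notMem h, h, hx.1]
      simp only [this]
  · intro ω
    by_cases h : ω ∈ (A : Set Ω)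
    · simp [indicatorRV_of_mem h]
    · simp [indicatorRV_of_notMem h]
  · intro ω
    by_cases h : ω ∈ (A : Set Ω)
    · simp [indicatorRV_of_mem h]
    · simp [indicatorRV_of_notMem h]

/-- Adding a multiple of an indicator to the argument of a submodular Choquet integral. -/
theorem choquet_add_smul_indicatorRV_le {w : Capacity Ω} (hw : w.IsSubmodular) (X : BddRV Ω)
    (A : MSet Ω) {h : ℝ} (hh : 0 ≤ h) :
    choquet w (X + h • indicatorRV A) ≤ choquet w X + h * w A := by
  obtain ⟨a, b, hab, ha, hb⟩ := exists_bounds X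
  have hA0 : ∀ ω, 0 ≤ (indicatorRV A).1 ω := fun ω => by
    by_cases hω : ω ∈ (A : Set Ω)
    · simp [indicatorRV_of_mem hω]
    · simp [indicatorRV_of_notMem hω]
  have hA1 : ∀ ω, (indicatorRV A).1 ω ≤ 1 := fun ω => by
    by_cases hω : ω ∈ (A : Set Ω)
    · simp [indicatorRV_of_mem hω]
    · simp [indicatorRV_of_notMem hω]
  rw [choquet_eq w (X := X) (b := b + h) ha (fun ω => (hb ω).trans (by linarith)),
    choquet_eq w (X := X + h • indicatorRV A) (a := a) (b := b + h)
    (fun ω => by simpa using add_le_add (ha ω) (mul_nonneg hh (hA0 ω)))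
    (fun ω => by simpa using add_le_add (hb ω) (mul_le_mul_of_nonneg_left (hA1 ω) hh))]
  -- Submodularity bounds the increment of the integrand by `k (x - h) - k x`. After a shift its
  -- integral leaves only `k` over `[a - h, a]`, which is at most `h * w A`, minus `k` over `[b, b +
  -- h]`, which is zero.
  let k : ℝ → ℝ := fun x => w (A ⊓ eventGE X x)
  have hk : Antitone k := fun x y hxy =>
    w.increasing _ _ (inter_subset_inter_right _ fun ω hω => hxy.trans hω)
  have hki : ∀ c d, IntervalIntegrable k volume c d := fun c d => hk.intervalIntegrable
  have hk' : Antitone fun x => k (x - h) := fun x y hxy => hk (by linarith)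
  have hk'i : ∀ c d, IntervalIntegrable (fun x => k (x - h)) volume c d :=
    fun c d => hk'.intervalIntegrable
  have key : ∀ x, w (eventGE (X + h • indicatorRV A) x)
      ≤ w (eventGE X x) + (k (x - h) - k x) := by
    intro x
    have h1 := hw (eventGE X x) (A ⊓ eventGE X (x - h))
    have h2 : eventGE X x ⊔ A ⊓ eventGE X (x - h) = eventGE (X + h • indicatorRV A) x :=
      Subtype.ext <| by
        ext ω
        change (x ≤ X.1 ω ∨ ω ∈ (A : Set Ω) ∧ x - h ≤ X.1 ω)
          ↔ x ≤ X.1 ω + h * (indicatorRV A).1 ω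
        by_cases hω : ω ∈ (A : Set Ω)
        · rw [indicatorRV_of_mem hω]
          constructor
          · rintro (h | h)
            · linarith
            · linarith [h.2]
          · intro h; right; exact ⟨hω, by linarith⟩
        · simp [indicatorRV_of_notMem hω, hω]
    have h3 : eventGE X x ⊓ (A ⊓ eventGE X (x - h)) = A ⊓ eventGE X x :=
      Subtype.ext <| by
        ext ω
        change (x ≤ X.1 ω ∧ ω ∈ (A : Set Ω) ∧ x - h ≤ X.1 ω) ↔ ω ∈ (A : Set Ω) ∧ x ≤ X.1 ω
        constructor
        · rintro ⟨p, q, -⟩; exact ⟨q, p⟩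
        · rintro ⟨q, p⟩; exact ⟨p, q, by linarith⟩
    rw [h2, h3] at h1
    simp only [k]
    linarith
  have hint := intervalIntegral.integral_mono_on (by linarith : a ≤ b + h)
    (intervalIntegrable_eventGE w (X + h • indicatorRV A) a (b + h))
    ((intervalIntegrable_eventGE w X a (b + h)).add ((hk'i _ _).sub (hki _ _))) fun x _ => key x
  rw [intervalIntegral.integral_add (intervalIntegrable_eventGE w X a (b + h))
    ((hk'i _ _).sub (hki _ _)), intervalIntegral.integral_sub (hk'i _ _) (hki _ _),
    intervalIntegral.integral_comp_sub_right k h, add_sub_cancel_right] at hint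
  have e1 := intervalIntegral.integral_add_adjacent_intervals (hki (a - h) a) (hki a b)
  have e2 := intervalIntegral.integral_add_adjacent_intervals (hki a b) (hki b (b + h))
  have e3 : ∫ x in b..b + h, k x = 0 := by
    rw [intervalIntegral.integral_of_le (by linarith)]
    refine setIntegral_eq_zero_of_forall_eq_zero fun x hx => w.eq_zero fun ω hω => ?_
    exact absurd ((show x ≤ X.1 ω from hω.2).trans (hb ω)) (not_le.2 hx.1)
  have e4 : ∫ x in (a - h)..a, k x ≤ h * w A := by
    have := intervalIntegral.integral_mono_on (by linarith : a - h ≤ a) (hki (a - h) a)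
      (intervalIntegrable_const (c := w A))
      fun x _ => w.increasing (A ⊓ eventGE X x) A inter_subset_left
    simpa using this
  linarith

/-! ### Approximation by staircases -/

/-- The staircase `h ∑_{k=1}^N 1_{Y ≥ a + k h}`. -/
noncomputable def staircase (Y : BddRV Ω) (a h : ℝ) (N : ℕ) : BddRV Ω :=
  ∑ k ∈ Finset.range N, h • indicatorRV (eventGE Y (a + h * (k + 1 : ℕ)))

/-- Either `Y ω` has reached the next level and the new step adds `h`, or the minimum is already `Y
ω`. The cap lets the induction run without an upper bound on `Y`. -/
theorem min_le_staircase (Y : BddRV Ω) (a h : ℝ) (N : ℕ) (ω : Ω) :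
    min (Y.1 ω) (a + h * (N + 1 : ℕ)) ≤ a + h + (staircase Y a h N).1 ω := by
  induction N with
  | zero => simp [staircase]
  | succ N ih =>
    have e : (staircase Y a h (N + 1)).1 ω = (staircase Y a h N).1 ω
        + h * (indicatorRV (eventGE Y (a + h * (N + 1 : ℕ)))).1 ω := by
      rw [staircase, Finset.sum_range_succ]; rfl
    rw [e]
    by_cases hω : a + h * (N + 1 : ℕ) ≤ Y.1 ω
    · rw [indicatorRV_of_mem (A := eventGE Y _) hω]
      rw [min_eq_right hω] at ih
      refine (min_le_right _ _).trans ?_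
      push_cast at ih ⊢
      linarith
    · rw [indicatorRV_of_notMem (A := eventGE Y _) hω]
      rw [min_eq_left (not_le.1 hω).le] at ih
      exact (min_le_left _ _).trans (by linarith)

theorem riemann_sum_le_integral {g : ℝ → ℝ} (hg : Antitone g) (a : ℝ) {h : ℝ} (hh : 0 < h)
    (N : ℕ) : ∑ k ∈ Finset.range N, h * g (a + h * (k + 1 : ℕ)) ≤ ∫ x in a..a + h * N, g x := by
  have h1 := AntitoneOn.sum_le_integral (x₀ := 0) (a := N) (f := fun x => g (a + h * x))
    fun x _ y _ hxy => hg (by gcongr)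
  have h2 := intervalIntegral.mul_integral_comp_add_mul (a := 0) (b := N) (f := g) h a
  rw [← Finset.mul_sum]
  simp only [zero_add] at h1
  rw [mul_zero, add_zero] at h2
  rw [← h2]
  exact mul_le_mul_of_nonneg_left h1 hh.le

/-- A monotone, translation-bounded functional whose increments along indicators are controlled
by `w` has increments controlled by the Choquet integral of `w`. -/
theorem add_le_add_choquet {w : Capacity Ω} {φ : BddRV Ω → ℝ}
    (hmono : ∀ X Y : BddRV Ω, (∀ ω, X.1 ω ≤ Y.1 ω) → φ X ≤ φ Y)
    (hconst : ∀ X c, φ (X + constRV c) ≤ φ X + c)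
    (hind : ∀ X A (h : ℝ), 0 ≤ h → φ (X + h • indicatorRV A) ≤ φ X + h * w A)
    (X Y : BddRV Ω) : φ (X + Y) ≤ φ X + choquet w Y := by
  obtain ⟨a, b, hab, ha, hb⟩ := exists_bounds Y
  have hstair : ∀ (X : BddRV Ω) (h : ℝ), 0 ≤ h → ∀ N : ℕ, φ (X + staircase Y a h N) ≤
      φ X + ∑ k ∈ Finset.range N, h * w (eventGE Y (a + h * (k + 1 : ℕ))) := by
    intro X h hh N
    induction N with
    | zero => simp [staircase]
    | succ N ih =>
      rw [staircase, Finset.sum_range_succ, Finset.sum_range_succ, ← add_assoc, ← add_assoc]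
      exact (hind _ _ _ hh).trans (by rw [staircase] at ih; linarith)
  refine le_of_forall_pos_le_add fun ε hε => ?_
  obtain ⟨N, hN⟩ := exists_nat_gt ((b - a) / ε)
  have hb' : b ≤ a + ε * N := by
    have := (div_lt_iff₀ hε).1 hN
    linarith
  -- The mesh is `ε` itself: the staircase misses `Y - a` by at most one step, and that step is the
  -- whole error.
  have hY : ∀ ω, (X + Y).1 ω ≤ (X + constRV (a + ε) + staircase Y a ε N).1 ω := by
    intro ω
    have h1 := min_le_staircase Y a ε N ω
    rw [min_eq_left (by push_cast; linarith [hb ω])] at h1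
    simp only [add_val_apply, constRV_apply]
    linarith
  have h1 := hmono _ _ hY
  have h2 := hstair (X + constRV (a + ε)) ε hε.le N
  have h3 := hconst X (a + ε)
  have h4 := riemann_sum_le_integral (antitone_eventGE w Y) a hε N
  rw [choquet_eq w ha (fun ω => (hb ω).trans hb')]
  linarith

theorem choquet_add_le {w : Capacity Ω} (hw : w.IsSubmodular) (X Y : BddRV Ω) :
    choquet w (X + Y) ≤ choquet w X + choquet w Y :=
  add_le_add_choquet (fun _ _ => choquet_mono w) (fun X c => (choquet_add_const w X c).le)
    (fun X A _ hh => choquet_add_smul_indicatorRV_le hw X A hh) X Y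

/-! ### Expected Shortfall as a Choquet integral -/

/-- The capacity `min (w / α) 1`. -/
noncomputable def Capacity.truncate (w : Capacity Ω) (α : ℝ) (hα : α ∈ Ioc (0 : ℝ) 1) :
    Capacity Ω where
  toFun A := min (w A / α) 1
  increasing A B h := min_le_min_right _ (div_le_div_of_nonneg_right (w.increasing A B h) hα.1.le)
  empty := by rw [w.empty]; simp
  whole := by rw [w.whole]; simp [(one_le_inv₀ hα.1).2 hα.2]

theorem Capacity.truncate_apply (w : Capacity Ω) {α : ℝ} (hα : α ∈ Ioc (0 : ℝ) 1) (A : MSet Ω) :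
    w.truncate α hα A = min (w A / α) 1 := rfl

theorem Capacity.IsSubmodular.truncate {w : Capacity Ω} (hw : w.IsSubmodular) {α : ℝ}
    (hα : α ∈ Ioc (0 : ℝ) 1) : (w.truncate α hα).IsSubmodular := by
  intro A B
  have hle : ∀ C D : MSet Ω, C ≤ D → w.truncate α hα C ≤ w.truncate α hα D :=
    fun C D h => (w.truncate α hα).increasing C D h
  have h1 := (w.truncate α hα).le_one (A ⊔ B)
  -- Where the truncation is active at `A` or `B`, monotonicity and the bound by one suffice.
  -- Otherwise the inequality is that of `w / α`.
  by_cases hA : 1 ≤ w A / α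
  · have : w.truncate α hα A = 1 := min_eq_right hA
    linarith [hle (A ⊓ B) B inf_le_right]
  by_cases hB : 1 ≤ w B / α
  · have : w.truncate α hα B = 1 := min_eq_right hB
    linarith [hle (A ⊓ B) A inf_le_left]
  have eA : w.truncate α hα A = w A / α := min_eq_left (not_le.1 hA).le
  have eB : w.truncate α hα B = w B / α := min_eq_left (not_le.1 hB).le
  have e1 : w.truncate α hα (A ⊔ B) ≤ w (A ⊔ B) / α := min_le_left _ _
  have e2 : w.truncate α hα (A ⊓ B) ≤ w (A ⊓ B) / α := min_le_left _ _
  have := div_le_div_of_nonneg_right (hw A B) hα.1.le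
  rw [add_div, add_div] at this
  linarith

theorem antitone_ite_lt {g : ℝ → ℝ} (hg : Antitone g) (t : ℝ) :
    Antitone fun x => if t < g x then (1 : ℝ) else 0 := by
  intro x y hxy
  have := hg hxy
  simp only
  split_ifs <;> linarith

/-- The integrand is one to the left of the quantile and zero to the right. Its value at the
quantile depends on whether the infimum is attained, but a point is null. -/
theorem integral_ite_lt_eq_VaR (w : Capacity Ω) {X : BddRV Ω} {a b t : ℝ}
    (hne : Nonempty Ω) (ha : ∀ ω, a ≤ X.1 ω) (hb : ∀ ω, X.1 ω ≤ b) (ht : t ∈ Ico (0 : ℝ) 1) :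
    ∫ x in a..b, (if t < w (eventGE X x) then (1 : ℝ) else 0) = VaR w t X - a := by
  have hab : a ≤ b := (ha hne.some).trans (hb hne.some)
  have hV : VaR w t X = sInf {x : ℝ | w (eventGE X x) ≤ t} := by
    simp [VaR, leftQuantile]
  set S := {x : ℝ | w (eventGE X x) ≤ t}
  have hlow : a ∈ lowerBounds S := fun x hx => by
    by_contra h
    have := eventGE_eq_one w ha (not_le.1 h).le
    have hx' : w (eventGE X x) ≤ t := hx
    linarith [ht.2]
  have hup : ∀ x, b < x → x ∈ S := fun x hx => by
    have := eventGE_eq_zero w hb hx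
    change w (eventGE X x) ≤ t
    linarith [ht.1]
  have hSne : S.Nonempty := ⟨b + 1, hup _ (by linarith)⟩
  have h1 : a ≤ VaR w t X := hV ▸ le_csInf hSne hlow
  have h2 : VaR w t X ≤ b := by
    rw [hV]
    exact le_of_forall_gt_imp_ge_of_dense fun x hx => csInf_le ⟨a, hlow⟩ (hup x hx)
  have hlt : ∀ x, x < VaR w t X → t < w (eventGE X x) := fun x hx => by
    by_contra h
    rw [hV] at hx
    exact absurd (csInf_le ⟨a, hlow⟩ (show x ∈ S from not_lt.1 h)) (not_le.2 hx)
  have hge : ∀ x, VaR w t X < x → ¬ t < w (eventGE X x) := fun x hx => by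
    rw [hV] at hx
    obtain ⟨y, hy, hyx⟩ := exists_lt_of_csInf_lt hSne hx
    exact not_lt.2 ((antitone_eventGE w X hyx.le).trans hy)
  have hanti := antitone_ite_lt (antitone_eventGE w X) t
  rw [← intervalIntegral.integral_add_adjacent_intervals (b := VaR w t X)
    hanti.intervalIntegrable hanti.intervalIntegrable]
  have i1 : ∫ x in a..VaR w t X, (if t < w (eventGE X x) then (1 : ℝ) else 0)
      = ∫ x in a..VaR w t X, (1 : ℝ) := by
    rw [intervalIntegral.integral_of_le h1, intervalIntegral.integral_of_le h1,
      integral_Ioc_eq_integral_Ioo, integral_Ioc_eq_integral_Ioo]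
    exact setIntegral_congr_fun measurableSet_Ioo fun x hx => if_pos (hlt x hx.2)
  have i2 : ∫ x in VaR w t X..b, (if t < w (eventGE X x) then (1 : ℝ) else 0) = 0 := by
    rw [intervalIntegral.integral_of_le h2]
    exact setIntegral_eq_zero_of_forall_eq_zero fun x hx => if_neg (hge x hx.1)
  rw [i1, i2]
  simp

theorem integral_ite_lt_eq_min {α y : ℝ} (hα : 0 ≤ α) (hy : 0 ≤ y) :
    ∫ t in (0 : ℝ)..α, (if t < y then (1 : ℝ) else 0) = min y α := by
  have hanti : Antitone fun t : ℝ => if t < y then (1 : ℝ) else 0 := by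
    intro s t hst
    simp only
    split_ifs <;> linarith
  have hm : (0 : ℝ) ≤ min y α := le_min hy hα
  rw [← intervalIntegral.integral_add_adjacent_intervals (b := min y α)
    hanti.intervalIntegrable hanti.intervalIntegrable]
  have i1 : ∫ t in (0 : ℝ)..min y α, (if t < y then (1 : ℝ) else 0)
      = ∫ t in (0 : ℝ)..min y α, (1 : ℝ) := by
    rw [intervalIntegral.integral_of_le hm, intervalIntegral.integral_of_le hm,
      integral_Ioc_eq_integral_Ioo, integral_Ioc_eq_integral_Ioo]
    exact setIntegral_congr_fun measurableSet_Ioo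
      fun x hx => if_pos (hx.2.trans_le (min_le_left _ _))
  have i2 : ∫ t in (min y α)..α, (if t < y then (1 : ℝ) else 0) = 0 := by
    rw [intervalIntegral.integral_of_le (min_le_right _ _)]
    refine setIntegral_eq_zero_of_forall_eq_zero fun t ht => if_neg fun h => ?_
    exact absurd ht.1 (not_lt.2 (le_min h.le ht.2))
  rw [i1, i2]
  simp

/-- Expected Shortfall is the Choquet integral with respect to the truncated capacity. -/
theorem ES_eq_choquet_truncate (w : Capacity Ω) {α : ℝ} (hα : α ∈ Ioc (0 : ℝ) 1) (X : BddRV Ω) :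
    ES w α X = choquet (w.truncate α hα) X := by
  have hne : Nonempty Ω := by
    by_contra h
    have h0 := w.eq_zero (A := ⟨univ, MeasurableSet.univ⟩) fun ω => (h ⟨ω⟩).elim
    rw [w.whole] at h0
    exact one_ne_zero h0
  obtain ⟨a, b, hab, ha, hb⟩ := exists_bounds X
  have hswap : ∫ t in (0 : ℝ)..α, ∫ x in a..b, (if t < w (eventGE X x) then (1 : ℝ) else 0)
      = ∫ x in a..b, ∫ t in (0 : ℝ)..α, (if t < w (eventGE X x) then (1 : ℝ) else 0) := by
    simp only [intervalIntegral.integral_of_le hab, intervalIntegral.integral_of_le hα.1.le]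
    refine integral_integral_swap ?_
    refine Integrable.of_bound (C := 1) ?_ ?_
    · refine Measurable.aestronglyMeasurable (Measurable.ite ?_ measurable_const measurable_const)
      exact measurableSet_lt measurable_fst
        ((antitone_eventGE w X).measurable.comp measurable_snd)
    · refine Filter.Eventually.of_forall fun p => ?_
      simp only [Function.uncurry]
      split_ifs <;> simp
  have hL : ∫ t in (0 : ℝ)..α, ∫ x in a..b, (if t < w (eventGE X x) then (1 : ℝ) else 0)
      = ∫ t in (0 : ℝ)..α, (VaR w t X - a) := by
    -- The right endpoint is dropped because `t = 1` occurs when `α = 1`; there the quantile set is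
    -- all of `ℝ` and `sInf` takes its default value.
    rw [intervalIntegral.integral_of_le hα.1.le, intervalIntegral.integral_of_le hα.1.le,
      integral_Ioc_eq_integral_Ioo, integral_Ioc_eq_integral_Ioo]
    exact setIntegral_congr_fun measurableSet_Ioo fun t ht =>
      integral_ite_lt_eq_VaR w hne ha hb ⟨ht.1.le, ht.2.trans_le hα.2⟩
  have hR : ∫ x in a..b, ∫ t in (0 : ℝ)..α, (if t < w (eventGE X x) then (1 : ℝ) else 0)
      = α * ∫ x in a..b, w.truncate α hα (eventGE X x) := by
    rw [← intervalIntegral.integral_const_mul]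
    refine intervalIntegral.integral_congr fun x _ => ?_
    rw [integral_ite_lt_eq_min hα.1.le (w.nonneg _), Capacity.truncate_apply,
      mul_min_of_nonneg _ _ hα.1.le, mul_div_cancel₀ _ hα.1.ne', mul_one]
  have hint : ∫ t in (0 : ℝ)..α, VaR w t X
      = α * a + α * ∫ x in a..b, w.truncate α hα (eventGE X x) := by
    -- The inner integral is antitone on the closed interval, including a possible endpoint `t = 1`,
    -- and agrees with `VaR w t X - a` almost everywhere.
    have hVi : IntervalIntegrable (fun t => VaR w t X - a) volume 0 α := by
      have hanti : AntitoneOn (fun t => ∫ x in a..b,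
          (if t < w (eventGE X x) then (1 : ℝ) else 0)) (uIcc 0 α) := by
        have hx := antitone_ite_lt (antitone_eventGE w X)
        intro s _ t _ hst
        refine intervalIntegral.integral_mono_on hab (hx t).intervalIntegrable
          (hx s).intervalIntegrable fun x _ => ?_
        split_ifs <;> linarith
      refine hanti.intervalIntegrable.congr_ae ?_
      rw [uIoc_of_le hα.1.le, ← restrict_Ioo_eq_restrict_Ioc]
      exact (ae_restrict_mem measurableSet_Ioo).mono fun t ht =>
        integral_ite_lt_eq_VaR w hne ha hb ⟨ht.1.le, ht.2.trans_le hα.2⟩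
    have e : ∫ t in (0 : ℝ)..α, VaR w t X = ∫ t in (0 : ℝ)..α, ((VaR w t X - a) + a) := by
      simp
    rw [e, intervalIntegral.integral_add hVi (by simp), ← hL, hswap, hR]
    simp [add_comm]
  rw [ES, hint, choquet_eq _ ha hb]
  have := hα.1.ne'
  field_simp

/-! ### Linear functionals below an inf-convolution -/

/-- If the inf-convolution of sublinear functionals is bounded below at `x₀`, then it is attained
there by a linear functional that is dominated by each of them. -/
theorem exists_linear_le_infConvolution {E ι : Type*} [AddCommGroup E] [Module ℝ E] [Fintype ι]
    {ρ : ι → E → ℝ} (hadd : ∀ i x y, ρ i (x + y) ≤ ρ i x + ρ i y)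
    (hsmul : ∀ i (c : ℝ), 0 < c → ∀ x, ρ i (c • x) = c * ρ i x) (hzero : ∀ i, ρ i 0 = 0)
    (hι : Nonempty ι) {x₀ : E} {m : ℝ}
    (hm : ∀ y : ι → E, ∑ i, y i = x₀ → m ≤ ∑ i, ρ i (y i)) :
    ∃ l : E →ₗ[ℝ] ℝ, (∀ i x, l x ≤ ρ i x) ∧ m ≤ l x₀ := by
  classical
  let i₀ := hι.some
  have hsingle : ∀ i x, ∑ j, (Pi.single i x : ι → E) j = x := fun i x => by
    simp
  have hρsingle : ∀ i x, ∑ j, ρ j ((Pi.single i x : ι → E) j) = ρ i x := fun i x => by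
    rw [Finset.sum_eq_single i]
    · simp
    · intro j _ hj; simp [hj, hzero]
    · simp
  let S : E → Set ℝ := fun x => {r | ∃ y : ι → E, ∑ i, y i = x ∧ r = ∑ i, ρ i (y i)}
  have hSne : ∀ x, (S x).Nonempty := fun x => ⟨_, Pi.single i₀ x, hsingle i₀ x, rfl⟩
  have hSbdd : ∀ x, BddBelow (S x) := by
    intro x
    -- Giving the remainder `x₀ - x` to `i₀` turns an allocation of `x` into one of `x₀`, so
    -- finiteness at one point spreads to all of `E`.
    refine ⟨m - ρ i₀ (x₀ - x), ?_⟩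
    rintro r ⟨y, hy, rfl⟩
    have h1 := hm (y + Pi.single i₀ (x₀ - x)) (by
      simp only [Pi.add_apply, Finset.sum_add_distrib, hsingle, hy]; abel)
    have h2 : ∑ i, ρ i ((y + Pi.single i₀ (x₀ - x) : ι → E) i)
        ≤ ∑ i, ρ i (y i) + ρ i₀ (x₀ - x) := by
      rw [← hρsingle i₀ (x₀ - x), ← Finset.sum_add_distrib]
      exact Finset.sum_le_sum fun i _ => hadd i _ _
    linarith
  let p : E → ℝ := fun x => sInf (S x)
  have hple : ∀ i x, p x ≤ ρ i x := fun i x =>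
    csInf_le (hSbdd x) ⟨Pi.single i x, hsingle i x, (hρsingle i x).symm⟩
  have hpadd : ∀ x y, p (x + y) ≤ p x + p y := by
    intro x y
    refine le_of_forall_pos_le_add fun ε hε => ?_
    obtain ⟨r, ⟨u, hu, rfl⟩, hr⟩ := exists_lt_of_csInf_lt (hSne x)
      (show p x < p x + ε / 2 by linarith)
    obtain ⟨s, ⟨v, hv, rfl⟩, hs⟩ := exists_lt_of_csInf_lt (hSne y)
      (show p y < p y + ε / 2 by linarith)
    have h1 : p (x + y) ≤ ∑ i, ρ i ((u + v) i) :=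
      csInf_le (hSbdd _) ⟨u + v, by simp [Finset.sum_add_distrib, hu, hv], rfl⟩
    have h2 : ∑ i, ρ i ((u + v) i) ≤ ∑ i, ρ i (u i) + ∑ i, ρ i (v i) := by
      rw [← Finset.sum_add_distrib]
      exact Finset.sum_le_sum fun i _ => hadd i _ _
    linarith
  have hpsmul_le : ∀ c : ℝ, 0 < c → ∀ x, p (c • x) ≤ c * p x := by
    intro c hc x
    rw [← div_le_iff₀' hc]
    refine le_csInf (hSne x) ?_
    rintro r ⟨y, hy, rfl⟩
    rw [div_le_iff₀' hc]
    refine csInf_le (hSbdd _) ⟨c • y, by simp [← Finset.smul_sum, hy], ?_⟩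
    rw [Finset.mul_sum]
    exact Finset.sum_congr rfl fun i _ => (hsmul i c hc _).symm
  have hpsmul : ∀ c : ℝ, 0 < c → ∀ x, p (c • x) = c * p x := by
    intro c hc x
    refine le_antisymm (hpsmul_le c hc x) ?_
    have := hpsmul_le c⁻¹ (inv_pos.2 hc) (c • x)
    rw [inv_smul_smul₀ hc.ne', ← div_eq_inv_mul, le_div_iff₀' hc] at this
    exact this
  have hp0 : p 0 = 0 := by
    have := hpsmul 2 two_pos 0
    rw [smul_zero] at this
    linarith
  have hmp : m ≤ p x₀ := le_csInf (hSne _) (by rintro r ⟨y, hy, rfl⟩; exact hm y hy)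
  -- Hahn–Banach extends `c • x₀ ↦ c * p x₀` from the line through `x₀`. For `x₀ = 0` the zero
  -- functional on the zero subspace serves, since `m ≤ p 0 = 0`.
  by_cases hx₀ : x₀ = 0
  · obtain ⟨l, -, hl⟩ := exists_extension_of_le_sublinear (⟨⊥, 0⟩ : E →ₗ.[ℝ] ℝ) p hpsmul hpadd
      (by rintro ⟨x, hx⟩
          have : x = 0 := hx
          subst this
          simp [hp0])
    refine ⟨l, fun i x => (hl x).trans (hple i x), ?_⟩
    rw [hx₀, hp0] at hmp
    simpa [hx₀] using hmp
  · obtain ⟨l, hext, hl⟩ := exists_extension_of_le_sublinear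
      (LinearPMap.mkSpanSingleton x₀ (p x₀) hx₀ : E →ₗ.[ℝ] ℝ) p hpsmul hpadd (by
        rintro ⟨x, hx⟩
        obtain ⟨c, rfl⟩ := Submodule.mem_span_singleton.1 hx
        rw [LinearPMap.mkSpanSingleton'_apply, smul_eq_mul]
        change c * p x₀ ≤ p (c • x₀)
        rcases lt_trichotomy c 0 with hc | rfl | hc
        · have h1 := hpadd (c • x₀) ((-c) • x₀)
          rw [← add_smul, add_neg_cancel, zero_smul, hp0, hpsmul (-c) (by linarith)] at h1
          linarith
        · simp [hp0]
        · exact (hpsmul c hc x₀).ge)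
    refine ⟨l, fun i x => (hl x).trans (hple i x), ?_⟩
    have h1 := hext ⟨x₀, Submodule.mem_span_singleton_self x₀⟩
    rw [LinearPMap.mkSpanSingleton_apply] at h1
    rw [h1]
    exact hmp

/-! ### The inf-convolution of Choquet integrals -/

theorem indicatorRV_sup_add_inf (A B : MSet Ω) :
    indicatorRV (A ⊔ B) + indicatorRV (A ⊓ B) = indicatorRV A + indicatorRV B :=
  Subtype.ext (indicator_union_add_inter (1 : Ω → ℝ) (A : Set Ω) (B : Set Ω))

/-- A linear functional dominated by a Choquet integral is dominated by the Choquet integral of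
the additive capacity that it induces. -/
theorem exists_capacity_of_linear_le {v : Capacity Ω} {l : BddRV Ω →ₗ[ℝ] ℝ}
    (hl : ∀ X, l X ≤ choquet v X) :
    ∃ u : Capacity Ω, u.IsSubmodular ∧ (∀ A, u A = l (indicatorRV A)) ∧
      ∀ X, l X ≤ choquet u X := by
  have hnonpos : ∀ X : BddRV Ω, (∀ ω, X.1 ω ≤ 0) → l X ≤ 0 := fun X hX =>
    (hl X).trans ((choquet_mono v (Y := 0) hX).trans (choquet_zero v).le)
  have hmono : ∀ X Y : BddRV Ω, (∀ ω, X.1 ω ≤ Y.1 ω) → l X ≤ l Y := by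
    intro X Y h
    have := hnonpos (X - Y) fun ω => sub_nonpos.2 (h ω)
    rw [map_sub] at this
    linarith
  have hconst : ∀ c, l (constRV c) = c := by
    intro c
    have h1 := (hl (constRV c)).trans (choquet_const v c).le
    have h2 := (hl (constRV (-c))).trans (choquet_const v (-c)).le
    have h3 : (constRV (-c) : BddRV Ω) = -constRV c := rfl
    rw [h3, map_neg] at h2
    linarith
  let u : Capacity Ω :=
    { toFun := fun A => l (indicatorRV A)
      increasing := fun A B h => hmono _ _ fun ω =>
        indicator_le_indicator_of_subset h (fun _ => zero_le_one) ω
      empty := by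
        have : (indicatorRV ⟨∅, MeasurableSet.empty⟩ : BddRV Ω) = 0 :=
          Subtype.ext (indicator_empty _)
        rw [this, map_zero]
      whole := by
        have : (indicatorRV ⟨univ, MeasurableSet.univ⟩ : BddRV Ω) = constRV 1 :=
          Subtype.ext (indicator_univ _)
        rw [this, hconst] }
  refine ⟨u, fun A B => ?_, fun A => rfl, fun X => ?_⟩
  · change l _ + l _ ≤ l _ + l _
    rw [← map_add, ← map_add, indicatorRV_sup_add_inf]
  -- Along indicators and constants the increments of `l` are exactly the allowed ones, so the
  -- staircase argument started at `0` applies.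
  · have := add_le_add_choquet (w := u) (φ := l) hmono
      (fun X c => by rw [map_add, hconst])
      (fun X A h _ => by rw [map_add, map_smul, smul_eq_mul]) 0 X
    simpa using this

theorem infConvolution_choquet {n : ℕ} (hn : 1 ≤ n) {v : Fin n → Capacity Ω}
    (hv : ∀ i, (v i).IsSubmodular) (X : BddRV Ω) :
    infConvolution (fun i => choquet (v i)) X =
      sSup {r : EReal | ∃ u : Capacity Ω, u.IsSubmodular ∧ (∀ A i, u A ≤ v i A) ∧
        r = (choquet u X : EReal)} := by
  apply le_antisymm
  -- Testing against real `m` below the infimum also covers the value `-∞`, where no such `m`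
  -- exists.
  · refine EReal.ge_of_forall_gt_iff_ge.1 fun m hm => ?_
    have hbd : ∀ Y : Fin n → BddRV Ω, ∑ i, Y i = X → m ≤ ∑ i, choquet (v i) (Y i) := by
      intro Y hY
      exact EReal.coe_le_coe_iff.1 (hm.le.trans (iInf₂_le Y hY))
    obtain ⟨l, hl, hlX⟩ := exists_linear_le_infConvolution
      (fun i => choquet_add_le (hv i)) (fun i c hc Y => choquet_smul (v i) Y hc)
      (fun i => choquet_zero (v i)) ⟨⟨0, hn⟩⟩ hbd
    obtain ⟨u, hu, hul, hlu⟩ := exists_capacity_of_linear_le (hl ⟨0, hn⟩)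
    refine le_sSup_of_le ⟨u, hu, fun A i => ?_, rfl⟩ (EReal.coe_le_coe_iff.2 (hlX.trans (hlu X)))
    rw [hul, ← choquet_indicatorRV]
    exact hl i _
  · refine sSup_le ?_
    rintro r ⟨u, hu, huv, rfl⟩
    refine le_iInf₂ fun Y hY => EReal.coe_le_coe_iff.2 ?_
    have hY' : ∑ i, Y i = X := hY
    rw [← hY']
    exact (Finset.le_sum_of_subadditive _ (choquet_zero u).le (choquet_add_le hu) _ _).trans
      (Finset.sum_le_sum fun i _ => choquet_mono_capacity (fun A => huv A i) _)

theorem infConvolution_ES {n : ℕ} (hn : 1 ≤ n) {α : Fin n → ℝ} (hα : ∀ i, α i ∈ Ioc (0 : ℝ) 1)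
    {w : Fin n → Capacity Ω} (hw : ∀ i, (w i).IsSubmodular) (X : BddRV Ω) :
    infConvolution (fun i => ES (w i) (α i)) X =
      sSup {r : EReal | ∃ u : Capacity Ω, u.IsSubmodular ∧
        (∀ A : MSet Ω, u A ≤ ⨅ i, w i A / α i) ∧ r = (choquet u X : EReal)} := by
  have hES : (fun i => ES (w i) (α i)) = fun i => choquet ((w i).truncate (α i) (hα i)) :=
    funext fun i => funext fun X => ES_eq_choquet_truncate (w i) (hα i) X
  have : Nonempty (Fin n) := ⟨⟨0, hn⟩⟩
  rw [hES, infConvolution_choquet hn fun i => (hw i).truncate (hα i)]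
  -- Truncation at one costs nothing, because a capacity never exceeds one.
  have hiff : ∀ u : Capacity Ω, (∀ A i, u A ≤ (w i).truncate (α i) (hα i) A) ↔
      ∀ A, u A ≤ ⨅ i, w i A / α i := fun u => forall_congr' fun A =>
    ⟨fun h => le_ciInf fun i => (h i).trans (min_le_left _ _), fun h i =>
      le_min (h.trans (ciInf_le (finite_range _).bddBelow i)) (u.le_one A)⟩
  simp only [hiff]

theorem infConvolution_ES_same {n : ℕ} (hn : 1 ≤ n) {α : Fin n → ℝ}
    (hα : ∀ i, α i ∈ Ioc (0 : ℝ) 1) {w : Capacity Ω} (hw : w.IsSubmodular) (X : BddRV Ω) :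
    infConvolution (fun i => ES w (α i)) X = (ES w (⨆ i, α i) X : EReal) := by
  have : Nonempty (Fin n) := ⟨⟨0, hn⟩⟩
  obtain ⟨j, hj⟩ := exists_eq_ciSup_of_finite (f := α)
  have hmax : ∀ i, α i ≤ α j := fun i => hj ▸ le_ciSup (finite_range α).bddAbove i
  rw [infConvolution_ES hn hα (fun _ => hw), ← hj, ES_eq_choquet_truncate w (hα j)]
  apply le_antisymm
  · refine sSup_le ?_
    rintro r ⟨u, -, huw, rfl⟩
    refine EReal.coe_le_coe_iff.2 (choquet_mono_capacity (fun A => ?_) X)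
    exact le_min ((huw A).trans (ciInf_le (finite_range _).bddBelow j)) (u.le_one A)
  -- The truncation at the largest level is itself admissible, so the supremum is attained there.
  · refine le_sSup ⟨_, hw.truncate (hα j), fun A => le_ciInf fun i => ?_, rfl⟩
    exact (min_le_left _ _).trans
      (div_le_div_of_nonneg_left (w.nonneg A) (hα i).1 (hmax i))

end ChoquetES

theorem mainTheorem8 {Ω : Type*} [MeasurableSpace Ω] (n : ℕ) (hn : 1 ≤ n)
    (α : Fin n → ℝ) (hα : ∀ i, α i ∈ Set.Ioc (0 : ℝ) 1) :
    (∀ w : Fin n → ChoquetES.Capacity Ω, (∀ i, (w i).IsSubmodular) →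
      ∀ X : ChoquetES.BddRV Ω,
        ChoquetES.infConvolution (fun i => ChoquetES.ES (w i) (α i)) X =
          sSup {r : EReal | ∃ u : ChoquetES.Capacity Ω, u.IsSubmodular ∧
            (∀ A : ChoquetES.MSet Ω, u A ≤ ⨅ i, w i A / α i) ∧
            r = (ChoquetES.choquet u X : EReal)}) ∧
    (∀ w : ChoquetES.Capacity Ω, w.IsSubmodular →
      ∀ X : ChoquetES.BddRV Ω,
        ChoquetES.infConvolution (fun i => ChoquetES.ES w (α i)) X =
          (ChoquetES.ES w (⨆ i, α i) X : EReal)) :=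
  ⟨fun _ hw X => ChoquetES.infConvolution_ES hn hα hw X,
    fun _ hw X => ChoquetES.infConvolution_ES_same hn hα hw X⟩
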